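/- Let $d\ge 1$ be an integer. For $a>0$, $\alpha>\frac d2$, $\beta>\alpha$ and $\gamma>\alpha$ with $\beta-\alpha+\gamma>\frac d2+1$ let $$G_d(\boldsymbol h;a,\alpha,\beta,\gamma)=\frac{\Gamma(\beta-\frac d2)\,\Gamma(\gamma-\frac d2)}{\Gamma(\beta-\alpha+\gamma-\frac d2)\,\Gamma(\alpha-\frac d2)}\Bigl(1-\frac{\|\boldsymbol h\|^2}{a^2}\Bigr)_+^{\beta-\alpha+\gamma-\frac d2-1}\,{}_2F_1\Bigl(\beta-\alpha,\gamma-\alpha;\beta-\alpha+\gamma-\tfrac d2;\Bigl(1-\frac{\|\boldsymbol h\|^2}{a^2}\Bigr)_+\Bigr),\quad \boldsymbol h\in\mathbb R^d,$$ be the Gauss hypergeometric covariance, where $\|\cdot\|$ is the Euclidean norm and $(x)_+=\max(x,0)$, and let $$L(p,q,x)=\frac1{\Gamma(q-p)}\int_1^{+\infty}e^{-ux}\,u^{p-1}(u-1)^{q-p-1}\,du,\qquad x\ge 0,\ q>p,$$ be the Laguerre function of the second kind. Fix $\alpha>\frac d2$, $\beta>\alpha$ and $b>0$. As $a$ and $\gamma$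 tend to $+\infty$ in such a way that $\frac{a}{\sqrt\gamma}\to b$, the function $G_d(\cdot;a,\alpha,\beta,\gamma)$ converges, uniformly on $\mathbb R^d$, to $$\boldsymbol h\mapsto\frac{\Gamma(\beta-\frac d2)}{\Gamma(\alpha-\frac d2)}\,L\Bigl(\frac d2-\beta+1,\ \frac d2-\alpha+1,\ \frac{\|\boldsymbol h\|^2}{b^2}\Bigr),\qquad \boldsymbol h\in\mathbb R^d,$$ and this limit is a covariance (that is, symmetric positive semidefinite) kernel on $\mathbb R^d$. The same result holds with $\beta$ and $\gamma$ interchanged: for fixed $\gamma>\alpha$, as $a,\beta\to+\infty$ with $\frac a{\sqrt\beta}\to b$, $G_d(\cdot;a,\alpha,\beta,\gamma)$ converges uniformly on $\mathbb R^d$ to the covariance kernel obtained from the one above by replacing $\beta$ by $\gamma$. -/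

import Mathlib

open Filter Topology

noncomputable section

/-- The Gauss hypergeometric covariance on `ℝ^d` with range `a` and parameters `α, β, γ`:
`Γ(β - d/2) Γ(γ - d/2) / (Γ(β - α + γ - d/2) Γ(α - d/2)) · z ^ (β - α + γ - d/2 - 1) ·
₂F₁(β - α, γ - α; β - α + γ - d/2; z)`, where `z = (1 - ‖h‖² / a²)₊`. -/
def gaussHypergeometricCovariance (d : ℕ) (a α β γ : ℝ) (h : EuclideanSpace ℝ (Fin d)) : ℝ :=
  Real.Gamma (β - d / 2) * Real.Gamma (γ - d / 2) /
      (Real.Gamma (β - α + γ - d / 2) * Real.Gamma (α - d / 2)) *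
    (max (1 - ‖h‖ ^ 2 / a ^ 2) 0) ^ (β - α + γ - d / 2 - 1) *
    ordinaryHypergeometric (β - α) (γ - α) (β - α + γ - d / 2) (max (1 - ‖h‖ ^ 2 / a ^ 2) 0)

/-- The Laguerre function of the second kind
`L(p, q, x) = 1 / Γ(q - p) · ∫_1^∞ exp(-u x) u ^ (p - 1) (u - 1) ^ (q - p - 1) du`
(for `x ≥ 0` and `q > p`). -/
def laguerreSecondKind (p q x : ℝ) : ℝ :=
  1 / Real.Gamma (q - p) *
    ∫ u in Set.Ioi (1 : ℝ), Real.exp (-(u * x)) * u ^ (p - 1) * (u - 1) ^ (q - p - 1)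

/-- The generalized Laguerre kernel
`h ↦ Γ(β - d/2) / Γ(α - d/2) · L(d/2 - β + 1, d/2 - α + 1, ‖h‖² / b²)` on `ℝ^d`. -/
def laguerreKernel (d : ℕ) (b α β : ℝ) (h : EuclideanSpace ℝ (Fin d)) : ℝ :=
  Real.Gamma (β - d / 2) / Real.Gamma (α - d / 2) *
    laguerreSecondKind (d / 2 - β + 1) (d / 2 - α + 1) (‖h‖ ^ 2 / b ^ 2)

/-- `K` is a (stationary) covariance kernel: for all finitely many points `x₁, …, xₙ` the matrix
with entries `K (xᵢ - xⱼ)` is symmetric and positive semidefinite. -/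
def IsCovarianceKernel {E : Type*} [AddGroup E] (K : E → ℝ) : Prop :=
  ∀ (n : ℕ) (x : Fin n → E), (Matrix.of fun i j => K (x i - x j)).PosSemidef

end

/-! Both functions of `h` are mixtures over `u > 1` with the same weight `ρ(u) = u^(-(β-d/2))
(u-1)^(β-α-1)` and the same constant. The Gauss covariance mixes `(1 - u‖h‖²/a²)₊^m`, `m = γ-d/2-1`
(Euler's integral and a substitution); the Laguerre kernel mixes `exp(-u‖h‖²/b²)`. The weight does
not involve `a` or `γ` and is integrable because `d/2 < α < β`. It therefore suffices to compare the
integrands uniformly in `u` and `h`: `(1-v)₊^m` is within `2/m` of `exp(-mv)`, and `exp(-cy)`,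
`exp(-ky)` are uniformly close when `c = m/a²` is close to `k = 1/b²`. Positive semidefiniteness is
not obtained from the limit: the Laguerre kernel is a nonnegative mixture of Gaussians.
Interchanging `β` and `γ` is the symmetry of `₂F₁`. -/

section

open MeasureTheory Set

/-! ### Beta integrals -/

theorem rpow_mul_one_sub_rpow_nonneg {x : ℝ} (hx : x ∈ Ioo (0 : ℝ) 1) (p q : ℝ) :
    0 ≤ x ^ p * (1 - x) ^ q :=
  mul_nonneg (Real.rpow_nonneg hx.1.le _) (Real.rpow_nonneg (sub_nonneg.2 hx.2.le) _)

theorem lintegral_rpow_mul_one_sub_rpow {p q : ℝ} (hp : 0 < p) (hq : 0 < q) :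
    ∫⁻ x in Ioo (0 : ℝ) 1, ENNReal.ofReal (x ^ (p - 1) * (1 - x) ^ (q - 1)) =
      ENNReal.ofReal (ProbabilityTheory.beta p q) := by
  have h := ProbabilityTheory.lintegral_betaPDF_eq_one hp hq
  have hB := ProbabilityTheory.beta_pos hp hq
  have key : ∀ x : ℝ, ENNReal.ofReal (1 / ProbabilityTheory.beta p q * x ^ (p - 1) *
      (1 - x) ^ (q - 1)) = ENNReal.ofReal (1 / ProbabilityTheory.beta p q) *
        ENNReal.ofReal (x ^ (p - 1) * (1 - x) ^ (q - 1)) := fun x => by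
    rw [mul_assoc, ENNReal.ofReal_mul (by positivity)]
  rw [ProbabilityTheory.lintegral_betaPDF] at h
  simp_rw [key] at h
  rw [lintegral_const_mul _ (by fun_prop)] at h
  calc _ = ENNReal.ofReal (ProbabilityTheory.beta p q) *
        (ENNReal.ofReal (1 / ProbabilityTheory.beta p q) *
          ∫⁻ x in Ioo (0 : ℝ) 1, ENNReal.ofReal (x ^ (p - 1) * (1 - x) ^ (q - 1))) := by
        rw [← mul_assoc, ← ENNReal.ofReal_mul hB.le, mul_one_div_cancel hB.ne',
          ENNReal.ofReal_one, one_mul]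
    _ = _ := by rw [h, mul_one]

theorem integrableOn_rpow_mul_one_sub_rpow {p q : ℝ} (hp : 0 < p) (hq : 0 < q) :
    IntegrableOn (fun x : ℝ => x ^ (p - 1) * (1 - x) ^ (q - 1)) (Ioo 0 1) := by
  refine ⟨Measurable.aestronglyMeasurable (by fun_prop), ?_⟩
  rw [hasFiniteIntegral_iff_ofReal
    (ae_restrict_of_forall_mem measurableSet_Ioo fun x hx => rpow_mul_one_sub_rpow_nonneg hx _ _),
    lintegral_rpow_mul_one_sub_rpow hp hq]
  exact ENNReal.ofReal_lt_top

theorem integral_rpow_mul_one_sub_rpow {p q : ℝ} (hp : 0 < p) (hq : 0 < q) :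
    ∫ x in Ioo (0 : ℝ) 1, x ^ (p - 1) * (1 - x) ^ (q - 1) =
      Real.Gamma p * Real.Gamma q / Real.Gamma (p + q) := by
  rw [integral_eq_lintegral_of_nonneg_ae
    (ae_restrict_of_forall_mem measurableSet_Ioo fun x hx => rpow_mul_one_sub_rpow_nonneg hx _ _)
    (Measurable.aestronglyMeasurable (by fun_prop)), lintegral_rpow_mul_one_sub_rpow hp hq,
    ENNReal.toReal_ofReal (ProbabilityTheory.beta_pos hp hq).le]
  rfl

/-! ### Binomial series and Euler's integral -/

theorem Real.Gamma_add_natCast_eq_ascPochhammer_eval_mul {x : ℝ} (hx : 0 < x) (n : ℕ) :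
    Real.Gamma (x + n) = (ascPochhammer ℝ n).eval x * Real.Gamma x := by
  induction n with
  | zero => simp
  | succ n ih =>
    rw [ascPochhammer_succ_eval, Nat.cast_succ, ← add_assoc,
      Real.Gamma_add_one (by positivity), ih]
    ring

/-- The binomial series `(1 - y)^(-b) = ∑ (b)ₙ / n! · yⁿ`. -/
theorem Real.hasSum_ascPochhammer_one_sub_rpow_neg (b : ℝ) {y : ℝ} (hy0 : 0 ≤ y) (hy1 : y < 1) :
    HasSum (fun n : ℕ => ((n.factorial : ℝ)⁻¹ * (ascPochhammer ℝ n).eval b) * y ^ n)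
      ((1 - y) ^ (-b)) := by
  have h := (Real.one_div_one_sub_rpow_hasFPowerSeriesOnBall_zero b).hasSum (y := y)
    (by simp [abs_of_nonneg hy0, enorm_eq_nnnorm, ← NNReal.coe_lt_coe, hy1])
  rw [zero_add, one_div, ← Real.rpow_neg (by linarith)] at h
  convert! h using 2 with n
  have hn : (n.factorial : ℝ) ≠ 0 := by positivity
  have hm := Ring.factorial_nsmul_multichoose_eq_ascPochhammer b n
  rw [Polynomial.ascPochhammer_smeval_cast, Polynomial.ascPochhammer_smeval_eq_eval,
    Ring.multichoose_eq, nsmul_eq_mul] at hm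
  rw [FormalMultilinearSeries.ofScalars_apply_eq, ← hm, inv_mul_cancel_left₀ hn, smul_eq_mul]

/-- Euler's integral representation of the Gauss hypergeometric function for real `z ∈ [0, 1]`,
where `c = a + e`. -/
theorem ordinaryHypergeometric_euler_integral {a b e z : ℝ} (ha : 0 < a) (hb : 0 < b)
    (hbe : b < e) (hz0 : 0 ≤ z) (hz1 : z ≤ 1) :
    Real.Gamma a * Real.Gamma e / Real.Gamma (a + e) * ordinaryHypergeometric a b (a + e) z =
      ∫ x in Ioo (0 : ℝ) 1, x ^ (a - 1) * (1 - x) ^ (e - 1) * (1 - z * x) ^ (-b) := by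
  have he : 0 < e := hb.trans hbe
  set F : ℕ → ℝ → ℝ := fun n x => x ^ (a - 1) * (1 - x) ^ (e - 1) *
    (((n.factorial : ℝ)⁻¹ * (ascPochhammer ℝ n).eval b) * (z * x) ^ n) with hF
  have hsum : ∀ x ∈ Ioo (0 : ℝ) 1,
      HasSum (fun n => F n x) (x ^ (a - 1) * (1 - x) ^ (e - 1) * (1 - z * x) ^ (-b)) := fun x hx =>
    (Real.hasSum_ascPochhammer_one_sub_rpow_neg b (mul_nonneg hz0 hx.1.le)
      (by nlinarith [hx.1, hx.2])).mul_left _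
  have hnn : ∀ n, ∀ x ∈ Ioo (0 : ℝ) 1, 0 ≤ F n x := fun n x hx =>
    mul_nonneg (rpow_mul_one_sub_rpow_nonneg hx _ _) (mul_nonneg (mul_nonneg (by positivity)
      (ascPochhammer_pos n b hb).le) (pow_nonneg (mul_nonneg hz0 hx.1.le) n))
  have hmeas : ∀ n, AEStronglyMeasurable (F n) (volume.restrict (Ioo 0 1)) := fun n =>
    Measurable.aestronglyMeasurable (by fun_prop)
  have hint : IntegrableOn
      (fun x : ℝ => x ^ (a - 1) * (1 - x) ^ (e - 1) * (1 - z * x) ^ (-b)) (Ioo 0 1) := by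
    -- Since `(1-zx)^(-b) ≤ (1-x)^(-b)`, a Beta integrand with exponents `a`, `e-b` dominates; this
    -- covers `z = 1`, i.e. `h = 0`.
    refine (integrableOn_rpow_mul_one_sub_rpow ha (sub_pos.2 hbe)).mono'
      (Measurable.aestronglyMeasurable (by fun_prop))
      (ae_restrict_of_forall_mem measurableSet_Ioo fun x hx => ?_)
    have h1 : 0 < 1 - x := sub_pos.2 hx.2
    have h2 : 1 - x ≤ 1 - z * x := by nlinarith [hx.1]
    rw [Real.norm_of_nonneg (mul_nonneg (rpow_mul_one_sub_rpow_nonneg hx _ _)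
      (Real.rpow_nonneg (h1.le.trans h2) _)),
      show e - b - 1 = (e - 1) + (-b) by ring, Real.rpow_add h1]
    rw [← mul_assoc]
    exact mul_le_mul_of_nonneg_left (Real.rpow_le_rpow_of_nonpos h1 h2 (by linarith))
      (rpow_mul_one_sub_rpow_nonneg hx _ _)
  -- The terms are nonnegative, so they serve as their own bounds.
  have hlim := hasSum_integral_of_dominated_convergence (μ := volume.restrict (Ioo 0 1)) F hmeas
    (fun n => ae_restrict_of_forall_mem measurableSet_Ioo fun x hx =>
      (Real.norm_of_nonneg (hnn n x hx)).le)
    (ae_restrict_of_forall_mem measurableSet_Ioo fun x hx => (hsum x hx).summable)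
    (hint.congr_fun (fun x hx => (hsum x hx).tsum_eq.symm) measurableSet_Ioo)
    (ae_restrict_of_forall_mem measurableSet_Ioo hsum)
  rw [← hlim.tsum_eq, ordinaryHypergeometric_eq_tsum, ← tsum_mul_left]
  refine tsum_congr fun n => ?_
  have hterm : ∫ x in Ioo (0 : ℝ) 1, F n x =
      ((n.factorial : ℝ)⁻¹ * (ascPochhammer ℝ n).eval b) * z ^ n *
        ∫ x in Ioo (0 : ℝ) 1, x ^ (a + n - 1) * (1 - x) ^ (e - 1) := by
    rw [← integral_const_mul]
    refine setIntegral_congr_fun measurableSet_Ioo fun x hx => ?_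
    simp only [hF]
    rw [show a + n - 1 = (a - 1) + n by ring, Real.rpow_add_natCast hx.1.ne', mul_pow]
    ring
  have hc := (ascPochhammer_pos n (a + e) (by positivity)).ne'
  have hG := (Real.Gamma_pos_of_pos (show 0 < a + e by positivity)).ne'
  rw [hterm, integral_rpow_mul_one_sub_rpow (by positivity) he,
    show a + n + e = a + e + n by ring, Real.Gamma_add_natCast_eq_ascPochhammer_eval_mul ha,
    Real.Gamma_add_natCast_eq_ascPochhammer_eval_mul (by positivity), smul_eq_mul]
  field_simp

/-! ### The substitution `u = 1/(1-(1-w)x)` -/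

theorem image_inv_one_sub_mul_Ioo {w : ℝ} (hw0 : 0 ≤ w) (hw1 : w < 1) :
    (fun x : ℝ => (1 - (1 - w) * x)⁻¹) '' Ioo 0 1 = {u | 1 < u ∧ u * w < 1} := by
  have hz : 0 < 1 - w := sub_pos.2 hw1
  ext u
  constructor
  · rintro ⟨x, ⟨hx0, hx1⟩, rfl⟩
    have h : 0 < 1 - (1 - w) * x := by nlinarith
    refine ⟨(one_lt_inv₀ h).2 (by nlinarith), ?_⟩
    rw [inv_mul_lt_iff₀ h]
    nlinarith
  · rintro ⟨hu1, hu2⟩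
    have hu : 0 < u := by linarith
    refine ⟨(u - 1) / (u * (1 - w)), ⟨by apply div_pos <;> nlinarith, ?_⟩, ?_⟩
    · rw [div_lt_one (by positivity)]
      nlinarith
    · change (1 - (1 - w) * ((u - 1) / (u * (1 - w))))⁻¹ = u
      rw [inv_eq_iff_eq_inv]
      field_simp
      ring

theorem hasDerivAt_inv_one_sub_mul {z x : ℝ} (h : 0 < 1 - z * x) :
    HasDerivAt (fun x : ℝ => (1 - z * x)⁻¹) (z * ((1 - z * x)⁻¹) ^ 2) x := by
  have h1 : HasDerivAt (fun x : ℝ => 1 - z * x) (-(z * 1)) x :=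
    ((hasDerivAt_id x).const_mul z).const_sub 1
  convert! h1.inv h.ne' using 1
  field_simp

theorem injOn_inv_one_sub_mul {z : ℝ} (hz : 0 < z) (s : Set ℝ) :
    InjOn (fun x : ℝ => (1 - z * x)⁻¹) s := fun x _ y _ hxy => by
  have h : z * x = z * y := by linarith [inv_injective hxy]
  exact mul_left_cancel₀ hz.ne' h

/-- With `z = 1-w`, one has `u-1 = zxu` and `1-uw = z(1-x)u`, so every factor splits into powers of
`z`, `x`, `1-x` and `u`. -/
theorem abs_deriv_smul_inv_one_sub_mul {w x : ℝ} (hw0 : 0 ≤ w) (hw1 : w < 1)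
    (hx : x ∈ Ioo (0 : ℝ) 1) (p e t : ℝ) :
    |(1 - w) * ((1 - (1 - w) * x)⁻¹) ^ 2| •
        (((1 - (1 - w) * x)⁻¹) ^ (-t) * ((1 - (1 - w) * x)⁻¹ - 1) ^ (p - 1) *
          (1 - (1 - (1 - w) * x)⁻¹ * w) ^ (e - 1)) =
      (1 - w) ^ (p + e - 1) *
        (x ^ (p - 1) * (1 - x) ^ (e - 1) * (1 - (1 - w) * x) ^ (-(p + e - t))) := by
  obtain ⟨hx0, hx1⟩ := hx
  have hz : 0 < 1 - w := sub_pos.2 hw1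
  have hx' : 0 < 1 - x := sub_pos.2 hx1
  have h : 0 < 1 - (1 - w) * x := by nlinarith
  set u := (1 - (1 - w) * x)⁻¹ with hu
  have hupos : 0 < u := inv_pos.2 h
  have h1 : u - 1 = (1 - w) * x * u := by rw [hu]; field_simp; ring
  have h2 : 1 - u * w = (1 - w) * (1 - x) * u := by rw [hu]; field_simp; ring
  have h3 : (1 - (1 - w) * x) ^ (-(p + e - t)) = u ^ (p + e - t) := by
    rw [hu, Real.inv_rpow h.le, Real.rpow_neg h.le]
  rw [h1, h2, h3, abs_of_pos (by positivity), smul_eq_mul, Real.mul_rpow (by positivity) hupos.le,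
    Real.mul_rpow hz.le hx0.le, Real.mul_rpow (by positivity) hupos.le,
    Real.mul_rpow hz.le hx'.le, show p + e - 1 = 1 + (p - 1) + (e - 1) by ring,
    Real.rpow_add hz, Real.rpow_add hz, Real.rpow_one,
    show p + e - t = 2 + -t + (p - 1) + (e - 1) by ring,
    Real.rpow_add hupos, Real.rpow_add hupos, Real.rpow_add hupos, Real.rpow_two]
  ring

theorem one_sub_mul_pos_of_mem_Ioo {w x : ℝ} (hw0 : 0 ≤ w) (hx : x ∈ Ioo (0 : ℝ) 1) :
    0 < 1 - (1 - w) * x := by nlinarith [hx.1, hx.2]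

theorem integral_rpow_neg_mul_sub_one_rpow_mul_one_sub_rpow {w : ℝ} (hw0 : 0 ≤ w) (hw1 : w < 1)
    (p e t : ℝ) :
    ∫ u in {u : ℝ | 1 < u ∧ u * w < 1}, u ^ (-t) * (u - 1) ^ (p - 1) * (1 - u * w) ^ (e - 1) =
      (1 - w) ^ (p + e - 1) * ∫ x in Ioo (0 : ℝ) 1,
        x ^ (p - 1) * (1 - x) ^ (e - 1) * (1 - (1 - w) * x) ^ (-(p + e - t)) := by
  rw [← image_inv_one_sub_mul_Ioo hw0 hw1, integral_image_eq_integral_abs_deriv_smul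
    measurableSet_Ioo (fun x hx => (hasDerivAt_inv_one_sub_mul
      (one_sub_mul_pos_of_mem_Ioo hw0 hx)).hasDerivWithinAt)
    (injOn_inv_one_sub_mul (sub_pos.2 hw1) _), ← integral_const_mul]
  exact setIntegral_congr_fun measurableSet_Ioo fun x hx =>
    abs_deriv_smul_inv_one_sub_mul hw0 hw1 hx p e t

/-- The substitution at `w = 0`, `e = 1` gives a Beta integrand with exponents `p`, `t-p`. -/
theorem integrableOn_rpow_neg_mul_sub_one_rpow {p t : ℝ} (hp : 0 < p) (hpt : p < t) :
    IntegrableOn (fun u : ℝ => u ^ (-t) * (u - 1) ^ (p - 1)) (Ioi 1) := by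
  have himage : (fun x : ℝ => (1 - (1 - 0) * x)⁻¹) '' Ioo 0 1 = Ioi 1 := by
    rw [image_inv_one_sub_mul_Ioo le_rfl one_pos]
    ext u
    simp
  rw [← himage, integrableOn_image_iff_integrableOn_abs_deriv_smul measurableSet_Ioo
    (fun x hx => (hasDerivAt_inv_one_sub_mul
      (one_sub_mul_pos_of_mem_Ioo le_rfl hx)).hasDerivWithinAt)
    (injOn_inv_one_sub_mul (by norm_num) _)]
  refine (integrableOn_rpow_mul_one_sub_rpow hp (sub_pos.2 hpt)).congr_fun (fun x hx => ?_)
    measurableSet_Ioo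
  have h := abs_deriv_smul_inv_one_sub_mul le_rfl one_pos hx p 1 t
  simp only [mul_zero, sub_zero, sub_self, Real.rpow_zero, mul_one, one_mul, Real.one_rpow] at h ⊢
  rw [h, show t - p - 1 = -(p + 1 - t) by ring]

/-! ### Mixture representations -/

/-- The Gauss hypergeometric covariance as a scale mixture of compactly supported kernels. -/
theorem gaussHypergeometricCovariance_eq_integral (d : ℕ) {a α β γ : ℝ} (hα : (d : ℝ) / 2 < α)
    (hβ : α < β) (hγ : α < γ) (hγd : 1 < γ - d / 2) (h : EuclideanSpace ℝ (Fin d)) :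
    gaussHypergeometricCovariance d a α β γ h =
      Real.Gamma (β - d / 2) / (Real.Gamma (α - d / 2) * Real.Gamma (β - α)) *
        ∫ u in Ioi (1 : ℝ), u ^ (-(β - d / 2)) * (u - 1) ^ (β - α - 1) *
          (max (1 - u * (‖h‖ ^ 2 / a ^ 2)) 0) ^ (γ - d / 2 - 1) := by
  unfold gaussHypergeometricCovariance
  set w := ‖h‖ ^ 2 / a ^ 2 with hw
  have hw0 : 0 ≤ w := by positivity
  have hzero : ∀ u : ℝ, 1 ≤ u * w →
      u ^ (-(β - d / 2)) * (u - 1) ^ (β - α - 1) * (max (1 - u * w) 0) ^ (γ - d / 2 - 1) = 0 := by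
    intro u hu
    rw [max_eq_right (by linarith), Real.zero_rpow (by linarith), mul_zero]
  rcases le_or_gt 1 w with hw1 | hw1
  -- Outside the support, `u > 1` and `w ≥ 1` make both sides vanish.
  · rw [max_eq_right (by linarith), Real.zero_rpow (by linarith),
      setIntegral_eq_zero_of_forall_eq_zero (t := Ioi 1) fun u hu => hzero u (by nlinarith [mem_Ioi.1 hu])]
    simp
  · have hset : ∫ u in Ioi (1 : ℝ), u ^ (-(β - d / 2)) * (u - 1) ^ (β - α - 1) *
          (max (1 - u * w) 0) ^ (γ - d / 2 - 1) =
        ∫ u in {u : ℝ | 1 < u ∧ u * w < 1}, u ^ (-(β - d / 2)) * (u - 1) ^ (β - α - 1) *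
          (1 - u * w) ^ (γ - d / 2 - 1) := by
      rw [setIntegral_eq_of_subset_of_forall_sdiff_eq_zero measurableSet_Ioi
        (s := {u : ℝ | 1 < u ∧ u * w < 1}) (fun u hu => hu.1)
        (fun u hu => hzero u (not_lt.1 fun hlt => hu.2 ⟨hu.1, hlt⟩))]
      refine setIntegral_congr_fun (measurableSet_lt measurable_const measurable_id |>.inter
        (measurableSet_lt (measurable_id.mul_const w) measurable_const)) fun u hu => ?_
      rw [max_eq_left (sub_nonneg.2 hu.2.le)]
    have he := ordinaryHypergeometric_euler_integral (a := β - α) (b := γ - α) (e := γ - d / 2)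
      (z := 1 - w) (by linarith) (by linarith) (by linarith) (by linarith) (by linarith)
    rw [hset, integral_rpow_neg_mul_sub_one_rpow_mul_one_sub_rpow hw0 hw1,
      max_eq_left (by linarith),
      show β - α + (γ - d / 2) - (β - d / 2) = γ - α by ring, ← he,
      show β - α + (γ - d / 2) = β - α + γ - d / 2 by ring]
    have h1 := (Real.Gamma_pos_of_pos (sub_pos.2 hβ)).ne'
    field_simp

theorem laguerreKernel_eq_integral (d : ℕ) (b α β : ℝ) (h : EuclideanSpace ℝ (Fin d)) :
    laguerreKernel d b α β h =
      Real.Gamma (β - d / 2) / (Real.Gamma (α - d / 2) * Real.Gamma (β - α)) *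
        ∫ u in Ioi (1 : ℝ), u ^ (-(β - d / 2)) * (u - 1) ^ (β - α - 1) *
          Real.exp (-(u * (‖h‖ ^ 2 / b ^ 2))) := by
  unfold laguerreKernel laguerreSecondKind
  rw [show (d : ℝ) / 2 - β + 1 - 1 = -(β - d / 2) by ring,
    show (d : ℝ) / 2 - α + 1 - (d / 2 - β + 1) = β - α by ring, ← mul_assoc,
    div_mul_div_comm, mul_one]
  congr 1
  exact integral_congr_ae (ae_of_all _ fun u => by ring)

theorem gaussHypergeometricCovariance_symm (d : ℕ) (a α β γ : ℝ) :
    gaussHypergeometricCovariance d a α β γ = gaussHypergeometricCovariance d a α γ β := by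
  funext h
  unfold gaussHypergeometricCovariance ordinaryHypergeometric
  rw [ordinaryHypergeometricSeries_symm, show β - α + γ = γ - α + β by ring,
    mul_comm (Real.Gamma (β - d / 2))]

/-! ### Uniform estimates -/

/-- For `c ≤ k` the difference is at most `exp(-cy)(k-c)y`, and `cy exp(-cy) ≤ 1` removes `y`. -/
theorem abs_exp_neg_mul_sub_exp_neg_mul_le {c k y : ℝ} (hc : 0 < c) (hk : 0 < k) (hy : 0 ≤ y) :
    |Real.exp (-(c * y)) - Real.exp (-(k * y))| ≤ |c - k| / min c k := by
  wlog hck : c ≤ k generalizing c k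
  · rw [abs_sub_comm, abs_sub_comm c, min_comm]
    exact this hk hc (le_of_not_ge hck)
  have h1 : Real.exp (-(k * y)) = Real.exp (-(c * y)) * Real.exp (-((k - c) * y)) := by
    rw [← Real.exp_add]; ring_nf
  have h2 : 1 - Real.exp (-((k - c) * y)) ≤ (k - c) * y := by
    linarith [Real.add_one_le_exp (-((k - c) * y))]
  have h3 : Real.exp (-(k * y)) ≤ Real.exp (-(c * y)) := Real.exp_le_exp.2 (by nlinarith)
  have h4 : c * y * Real.exp (-(c * y)) ≤ 1 := by
    rw [Real.exp_neg, ← div_eq_mul_inv, div_le_one (Real.exp_pos _)]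
    linarith [Real.add_one_le_exp (c * y)]
  rw [abs_of_nonneg (by linarith), abs_of_nonpos (by linarith), min_eq_left hck, le_div_iff₀ hc, h1]
  calc (Real.exp (-(c * y)) - Real.exp (-(c * y)) * Real.exp (-((k - c) * y))) * c
      = c * Real.exp (-(c * y)) * (1 - Real.exp (-((k - c) * y))) := by ring
    _ ≤ c * Real.exp (-(c * y)) * ((k - c) * y) := by gcongr
    _ = (k - c) * (c * y * Real.exp (-(c * y))) := by ring
    _ ≤ (k - c) * 1 := by gcongr
    _ = -(c - k) := by ring

/-- Above, `1-v ≤ exp(-v)`. Below, for `v < 1`, `exp(-v)(1-v²) ≤ 1-v` and Bernoulli (hence `m ≥ 1`)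
leave a defect `mv² exp(-mv)`, at most `2/m` because `t² exp(-t) ≤ 2`. -/
theorem abs_max_one_sub_rpow_sub_exp_le {m v : ℝ} (hm : 1 ≤ m) (hv : 0 ≤ v) :
    |(max (1 - v) 0) ^ m - Real.exp (-(m * v))| ≤ 2 / m := by
  have hm0 : 0 < m := by linarith
  have hle : (max (1 - v) 0) ^ m ≤ Real.exp (-(m * v)) := by
    rw [show -(m * v) = -v * m by ring, Real.exp_mul]
    refine Real.rpow_le_rpow (le_max_right _ _) (max_le ?_ (Real.exp_pos _).le) hm0.le
    linarith [Real.add_one_le_exp (-v)]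
  rw [abs_sub_comm, abs_of_nonneg (by linarith)]
  have hexp : (m * v) ^ 2 * Real.exp (-(m * v)) ≤ 2 := by
    rw [Real.exp_neg, ← div_eq_mul_inv, div_le_iff₀ (Real.exp_pos _)]
    nlinarith [Real.quadratic_le_exp_of_nonneg (show 0 ≤ m * v by positivity), mul_nonneg hm0.le hv]
  suffices hkey : Real.exp (-(m * v)) * (1 - m * v ^ 2) ≤ (max (1 - v) 0) ^ m by
    rw [le_div_iff₀ hm0]
    nlinarith
  rcases le_or_gt 1 v with hv1 | hv1
  · refine le_trans (mul_nonpos_of_nonneg_of_nonpos (Real.exp_pos _).le (by nlinarith)) ?_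
    exact Real.rpow_nonneg (le_max_right _ _) _
  · rw [max_eq_left (by linarith)]
    have hbern : 1 - m * v ^ 2 ≤ (1 - v ^ 2) ^ m := by
      have := one_add_mul_self_le_rpow_one_add (s := -v ^ 2) (by nlinarith) hm
      rw [← sub_eq_add_neg] at this
      linarith
    have hbase : Real.exp (-v) * (1 - v ^ 2) ≤ 1 - v := by
      have h1 : Real.exp (-v) * (1 + v) ≤ 1 := by
        rw [Real.exp_neg, inv_mul_le_one₀ (Real.exp_pos _)]
        linarith [Real.add_one_le_exp v]
      nlinarith
    calc Real.exp (-(m * v)) * (1 - m * v ^ 2) ≤ Real.exp (-(m * v)) * (1 - v ^ 2) ^ m := by gcongr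
      _ = (Real.exp (-v) * (1 - v ^ 2)) ^ m := by
        rw [Real.mul_rpow (Real.exp_pos _).le (by nlinarith), ← Real.exp_mul]
        ring_nf
      _ ≤ _ := Real.rpow_le_rpow (mul_nonneg (Real.exp_pos _).le (by nlinarith)) hbase hm0.le

/-- Quantitative comparison of the Gauss hypergeometric covariance and the Laguerre kernel. -/
theorem abs_gaussHypergeometricCovariance_sub_laguerreKernel_le (d : ℕ) {a b α β γ : ℝ}
    (ha : 0 < a) (hb : 0 < b) (hα : (d : ℝ) / 2 < α) (hβ : α < β) (hγ : α < γ)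
    (hγd : 2 ≤ γ - d / 2) (h : EuclideanSpace ℝ (Fin d)) :
    |gaussHypergeometricCovariance d a α β γ h - laguerreKernel d b α β h| ≤
      Real.Gamma (β - d / 2) / (Real.Gamma (α - d / 2) * Real.Gamma (β - α)) *
        ((∫ u in Ioi (1 : ℝ), u ^ (-(β - d / 2)) * (u - 1) ^ (β - α - 1)) *
          (2 / (γ - d / 2 - 1) + |(γ - d / 2 - 1) / a ^ 2 - 1 / b ^ 2| /
            min ((γ - d / 2 - 1) / a ^ 2) (1 / b ^ 2))) := by
  set m := γ - d / 2 - 1 with hm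
  have hm1 : 1 ≤ m := by linarith
  set ε := 2 / m + |m / a ^ 2 - 1 / b ^ 2| / min (m / a ^ 2) (1 / b ^ 2) with hε
  set ρ : ℝ → ℝ := fun u => u ^ (-(β - d / 2)) * (u - 1) ^ (β - α - 1) with hρ
  have hK : 0 ≤ Real.Gamma (β - d / 2) / (Real.Gamma (α - d / 2) * Real.Gamma (β - α)) :=
    div_nonneg (Real.Gamma_pos_of_pos (by linarith)).le
      (mul_nonneg (Real.Gamma_pos_of_pos (by linarith)).le (Real.Gamma_pos_of_pos (by linarith)).le)
  have hρint : IntegrableOn ρ (Ioi 1) :=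
    integrableOn_rpow_neg_mul_sub_one_rpow (sub_pos.2 hβ) (by linarith)
  have hρ0 : ∀ u ∈ Ioi (1 : ℝ), 0 ≤ ρ u := fun u (hu : 1 < u) =>
    mul_nonneg (Real.rpow_nonneg (by linarith) _) (Real.rpow_nonneg (by linarith) _)
  have hbdd : ∀ g : ℝ → ℝ, Measurable g → (∀ u ∈ Ioi (1 : ℝ), |g u| ≤ 1) →
      IntegrableOn (fun u => ρ u * g u) (Ioi 1) := fun g hg hg1 =>
    hρint.mul_bdd hg.aestronglyMeasurable (ae_restrict_of_forall_mem measurableSet_Ioi hg1)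
  have hr : 0 ≤ ‖h‖ ^ 2 := by positivity
  have hgint : IntegrableOn (fun u => ρ u * (max (1 - u * (‖h‖ ^ 2 / a ^ 2)) 0) ^ m) (Ioi 1) := by
    refine hbdd _ (by fun_prop) fun u (hu : 1 < u) => ?_
    have h0 : 0 ≤ u * (‖h‖ ^ 2 / a ^ 2) := by positivity
    rw [abs_of_nonneg (Real.rpow_nonneg (le_max_right _ _) _)]
    exact Real.rpow_le_one (le_max_right _ _) (max_le (by linarith) zero_le_one) (by linarith)
  have hlint : IntegrableOn (fun u => ρ u * Real.exp (-(u * (‖h‖ ^ 2 / b ^ 2)))) (Ioi 1) := by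
    refine hbdd _ (by fun_prop) fun u (hu : 1 < u) => ?_
    rw [Real.abs_exp, Real.exp_le_one_iff, neg_nonpos]
    positivity
  rw [gaussHypergeometricCovariance_eq_integral d hα hβ hγ (by linarith),
    laguerreKernel_eq_integral, ← mul_sub, abs_mul, abs_of_nonneg hK, ← integral_sub hgint hlint,
    ← integral_mul_const]
  refine mul_le_mul_of_nonneg_left ?_ hK
  rw [← Real.norm_eq_abs]
  refine norm_integral_le_of_norm_le (hρint.mul_const ε)
    (ae_restrict_of_forall_mem measurableSet_Ioi fun u hu => ?_)
  have hu0 : (0 : ℝ) < u := one_pos.trans hu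
  rw [← mul_sub, norm_mul, Real.norm_of_nonneg (hρ0 u hu)]
  refine mul_le_mul_of_nonneg_left ?_ (hρ0 u hu)
  rw [Real.norm_eq_abs, hε]
  -- The intermediate function is `exp(-mu‖h‖²/a²)`.
  have h1 := abs_max_one_sub_rpow_sub_exp_le hm1
    (show 0 ≤ u * (‖h‖ ^ 2 / a ^ 2) by positivity)
  have h2 := abs_exp_neg_mul_sub_exp_neg_mul_le (c := m / a ^ 2) (k := 1 / b ^ 2)
    (y := u * ‖h‖ ^ 2) (by positivity) (by positivity) (by positivity)
  rw [show m / a ^ 2 * (u * ‖h‖ ^ 2) = m * (u * (‖h‖ ^ 2 / a ^ 2)) by ring,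
    show 1 / b ^ 2 * (u * ‖h‖ ^ 2) = u * (‖h‖ ^ 2 / b ^ 2) by ring] at h2
  exact (abs_sub_le _ _ _).trans (add_le_add h1 h2)

/-! ### Passage to the limit -/

theorem tendsto_sub_div_sq_of_tendsto_div_sqrt {ι : Type*} {l : Filter ι} {a γ : ι → ℝ} {b : ℝ}
    (hb : 0 < b) (c : ℝ) (hγ : Tendsto γ l atTop)
    (hab : Tendsto (fun i => a i / √(γ i)) l (𝓝 b)) :
    Tendsto (fun i => (γ i - c) / a i ^ 2) l (𝓝 (1 / b ^ 2)) := by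
  have h1 : Tendsto (fun i => 1 - c / γ i) l (𝓝 (1 - 0)) :=
    tendsto_const_nhds.sub (hγ.const_div_atTop c)
  have h2 := h1.div (hab.pow 2) (by positivity)
  rw [sub_zero] at h2
  refine h2.congr' ?_
  filter_upwards [hγ.eventually_gt_atTop 0] with i hi
  simp only [Pi.div_apply]
  rw [div_pow, Real.sq_sqrt hi.le]
  field_simp

theorem tendstoUniformly_gaussHypergeometricCovariance (d : ℕ) {α β b : ℝ}
    (hα : (d : ℝ) / 2 < α) (hβ : α < β) (hb : 0 < b) {ι : Type*} {l : Filter ι} {a γ : ι → ℝ}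
    (ha : Tendsto a l atTop) (hγ : Tendsto γ l atTop)
    (hab : Tendsto (fun i => a i / √(γ i)) l (𝓝 b)) :
    TendstoUniformly (fun i => gaussHypergeometricCovariance d (a i) α β (γ i))
      (laguerreKernel d b α β) l := by
  have hm : Tendsto (fun i => (γ i - d / 2 - 1) / a i ^ 2) l (𝓝 (1 / b ^ 2)) := by
    simpa only [sub_sub] using tendsto_sub_div_sq_of_tendsto_div_sqrt hb ((d : ℝ) / 2 + 1) hγ hab
  have hm' : Tendsto (fun i => γ i - d / 2 - 1) l atTop := by
    simpa only [sub_eq_add_neg] using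
      tendsto_atTop_add_const_right _ (-1) (tendsto_atTop_add_const_right _ (-((d : ℝ) / 2)) hγ)
  have hb2 : 0 < 1 / b ^ 2 := by positivity
  have hbound := ((((hm'.const_div_atTop 2).add (((hm.sub_const (1 / b ^ 2)).abs).div
    (hm.min (tendsto_const_nhds (x := 1 / b ^ 2))) (by rw [min_self]; exact hb2.ne'))).const_mul
      (∫ u in Ioi (1 : ℝ), u ^ (-(β - d / 2)) * (u - 1) ^ (β - α - 1))).const_mul
        (Real.Gamma (β - d / 2) / (Real.Gamma (α - d / 2) * Real.Gamma (β - α))))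
  simp only [sub_self, abs_zero, zero_div, add_zero, mul_zero] at hbound
  rw [Metric.tendstoUniformly_iff]
  intro ε hε
  filter_upwards [hbound.eventually_lt_const hε, ha.eventually_gt_atTop 0,
    hγ.eventually_gt_atTop α, hm'.eventually_ge_atTop 1] with i hi hai hγi hmi h
  rw [dist_comm, Real.dist_eq]
  exact (abs_gaussHypergeometricCovariance_sub_laguerreKernel_le d hai hb hα hβ hγi
    (by linarith) h).trans_lt hi

/-! ### Positive semidefiniteness -/

theorem IsCovarianceKernel.of_sum_nonneg {E : Type*} [AddGroup E] {K : E → ℝ}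
    (hneg : ∀ x, K (-x) = K x)
    (hsum : ∀ (n : ℕ) (x : Fin n → E) (c : Fin n → ℝ),
      0 ≤ ∑ i, ∑ j, c i * c j * K (x i - x j)) : IsCovarianceKernel K := fun n x => by
  refine .of_dotProduct_mulVec_nonneg ?_ fun c => ?_
  · ext i j
    simp [Matrix.conjTranspose_apply, ← hneg (x i - x j)]
  · refine (hsum n x c).trans_eq ?_
    simp only [dotProduct, Matrix.mulVec, Matrix.of_apply, star_trivial, Finset.mul_sum]
    exact Finset.sum_congr rfl fun i _ => Finset.sum_congr rfl fun j _ => by ring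

theorem integrable_exp_neg_mul_sq_norm {V : Type*} [NormedAddCommGroup V] [InnerProductSpace ℝ V]
    [FiniteDimensional ℝ V] [MeasurableSpace V] [BorelSpace V] {b : ℝ} (hb : 0 < b) :
    Integrable fun v : V => Real.exp (-b * ‖v‖ ^ 2) := by
  -- A nonzero integral forces integrability, since the default value is `0`.
  refine not_imp_comm.1 integral_undef ?_
  rw [GaussianFourier.integral_rexp_neg_mul_sq_norm hb]
  positivity

/-- A Gaussian is, up to the factor `I > 0`, the convolution of two narrower ones, so `I` times the
quadratic form is the integral of a square. -/
theorem sum_mul_exp_neg_mul_sq_norm_sub_nonneg {V : Type*} [NormedAddCommGroup V]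
    [InnerProductSpace ℝ V] [FiniteDimensional ℝ V] [MeasurableSpace V] [BorelSpace V]
    {b : ℝ} (hb : 0 < b) {n : ℕ} (x : Fin n → V) (c : Fin n → ℝ) :
    0 ≤ ∑ i, ∑ j, c i * c j * Real.exp (-b * ‖x i - x j‖ ^ 2) := by
  have hI := GaussianFourier.integral_rexp_neg_mul_sq_norm (V := V) (b := 4 * b) (by positivity)
  set I := ∫ v : V, Real.exp (-(4 * b) * ‖v‖ ^ 2)
  have hIpos : 0 < I := by rw [hI]; positivity
  have hprod : ∀ p q v : V, Real.exp (-(2 * b) * ‖v - p‖ ^ 2) * Real.exp (-(2 * b) * ‖v - q‖ ^ 2) =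
      Real.exp (-b * ‖p - q‖ ^ 2) *
        Real.exp (-(4 * b) * ‖v - (2⁻¹ : ℝ) • (p + q)‖ ^ 2) := fun p q v => by
    rw [← Real.exp_add, ← Real.exp_add]
    congr 1
    simp only [← real_inner_self_eq_norm_sq, inner_sub_left, inner_sub_right, inner_add_left,
      inner_add_right, inner_smul_left, inner_smul_right, RCLike.conj_to_real,
      real_inner_comm v p, real_inner_comm v q, real_inner_comm p q]
    ring
  have hint : ∀ p q : V, Integrable fun v =>
      Real.exp (-(2 * b) * ‖v - p‖ ^ 2) * Real.exp (-(2 * b) * ‖v - q‖ ^ 2) := fun p q => by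
    simp_rw [hprod]
    exact ((integrable_exp_neg_mul_sq_norm (by positivity)).comp_sub_right _).const_mul _
  have hval : ∀ p q : V, ∫ v, Real.exp (-(2 * b) * ‖v - p‖ ^ 2) *
      Real.exp (-(2 * b) * ‖v - q‖ ^ 2) = Real.exp (-b * ‖p - q‖ ^ 2) * I := fun p q => by
    simp_rw [hprod, integral_const_mul]
    rw [integral_sub_right_eq_self fun v : V => Real.exp (-(4 * b) * ‖v‖ ^ 2)]
  have hsq : ∫ v, (∑ i, c i * Real.exp (-(2 * b) * ‖v - x i‖ ^ 2)) ^ 2 =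
      (∑ i, ∑ j, c i * c j * Real.exp (-b * ‖x i - x j‖ ^ 2)) * I := by
    have hexpand : ∀ v, (∑ i, c i * Real.exp (-(2 * b) * ‖v - x i‖ ^ 2)) ^ 2 =
        ∑ i, ∑ j, c i * c j * (Real.exp (-(2 * b) * ‖v - x i‖ ^ 2) *
          Real.exp (-(2 * b) * ‖v - x j‖ ^ 2)) := fun v => by
      rw [sq, Finset.sum_mul_sum]
      exact Finset.sum_congr rfl fun i _ => Finset.sum_congr rfl fun j _ => by ring
    simp_rw [hexpand]
    rw [integral_finsetSum _ fun i _ => integrable_finsetSum _ fun j _ => (hint _ _).const_mul _,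
      Finset.sum_mul]
    refine Finset.sum_congr rfl fun i _ => ?_
    rw [integral_finsetSum _ fun j _ => (hint _ _).const_mul _, Finset.sum_mul]
    refine Finset.sum_congr rfl fun j _ => ?_
    rw [integral_const_mul, hval, ← mul_assoc]
  exact nonneg_of_mul_nonneg_left (hsq ▸ integral_nonneg fun v => sq_nonneg _) hIpos

theorem isCovarianceKernel_laguerreKernel (d : ℕ) {α β b : ℝ} (hα : (d : ℝ) / 2 < α)
    (hβ : α < β) (hb : 0 < b) : IsCovarianceKernel (laguerreKernel d b α β) := by
  refine .of_sum_nonneg (fun x => by simp [laguerreKernel]) fun n x c => ?_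
  have hK : 0 ≤ Real.Gamma (β - d / 2) / (Real.Gamma (α - d / 2) * Real.Gamma (β - α)) :=
    div_nonneg (Real.Gamma_pos_of_pos (by linarith)).le
      (mul_nonneg (Real.Gamma_pos_of_pos (by linarith)).le (Real.Gamma_pos_of_pos (by linarith)).le)
  have hint : ∀ h : EuclideanSpace ℝ (Fin d), IntegrableOn (fun u : ℝ =>
      u ^ (-(β - d / 2)) * (u - 1) ^ (β - α - 1) * Real.exp (-(u * (‖h‖ ^ 2 / b ^ 2))))
      (Ioi 1) := fun h => by
    refine (integrableOn_rpow_neg_mul_sub_one_rpow (sub_pos.2 hβ) (by linarith)).mul_bdd (c := 1)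
      (Measurable.aestronglyMeasurable (by fun_prop))
      (ae_restrict_of_forall_mem measurableSet_Ioi fun u (hu : 1 < u) => ?_)
    rw [Real.norm_eq_abs, Real.abs_exp, Real.exp_le_one_iff, neg_nonpos]
    positivity
  have hsum : ∑ i, ∑ j, c i * c j * laguerreKernel d b α β (x i - x j) =
      Real.Gamma (β - d / 2) / (Real.Gamma (α - d / 2) * Real.Gamma (β - α)) *
        ∫ u in Ioi (1 : ℝ), ∑ i, ∑ j, c i * c j *
          (u ^ (-(β - d / 2)) * (u - 1) ^ (β - α - 1) *
            Real.exp (-(u * (‖x i - x j‖ ^ 2 / b ^ 2)))) := by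
    rw [integral_finsetSum _ fun i _ => integrable_finsetSum _ fun j _ => (hint _).const_mul _,
      Finset.mul_sum]
    refine Finset.sum_congr rfl fun i _ => ?_
    rw [integral_finsetSum _ fun j _ => (hint _).const_mul _, Finset.mul_sum]
    refine Finset.sum_congr rfl fun j _ => ?_
    rw [integral_const_mul, laguerreKernel_eq_integral]
    ring
  rw [hsum]
  refine mul_nonneg hK (setIntegral_nonneg measurableSet_Ioi fun u (hu : 1 < u) => ?_)
  -- For each fixed `u` the integrand is a nonnegative weight times a Gaussian quadratic form.
  have hg := sum_mul_exp_neg_mul_sq_norm_sub_nonneg (b := u / b ^ 2) (by positivity) x c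
  refine (mul_nonneg (mul_nonneg (Real.rpow_nonneg (show (0 : ℝ) ≤ u by linarith) (-(β - d / 2)))
    (Real.rpow_nonneg (show (0 : ℝ) ≤ u - 1 by linarith) (β - α - 1))) hg).trans_eq ?_
  simp_rw [Finset.mul_sum]
  refine Finset.sum_congr rfl fun i _ => Finset.sum_congr rfl fun j _ => ?_
  rw [show -(u / b ^ 2) * ‖x i - x j‖ ^ 2 = -(u * (‖x i - x j‖ ^ 2 / b ^ 2)) by ring]
  ring

end

theorem theorem12 (d : ℕ) (hd : 1 ≤ d) (α : ℝ) (hα : (d : ℝ) / 2 < α) (b : ℝ) (hb : 0 < b)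
    {ι : Type*} (l : Filter ι) :
    -- `β` fixed, `a` and `γ` tending to infinity with `a / √γ → b`
    (∀ β : ℝ, α < β →
      IsCovarianceKernel (laguerreKernel d b α β) ∧
      ∀ a γ : ι → ℝ,
        Tendsto a l atTop → Tendsto γ l atTop → Tendsto (fun i => a i / √(γ i)) l (𝓝 b) →
        TendstoUniformly (fun i => gaussHypergeometricCovariance d (a i) α β (γ i))
          (laguerreKernel d b α β) l) ∧
    -- `γ` fixed, `a` and `β` tending to infinity with `a / √β → b`
    (∀ γ : ℝ, α < γ →
      IsCovarianceKernel (laguerreKernel d b α γ) ∧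
      ∀ a β : ι → ℝ,
        Tendsto a l atTop → Tendsto β l atTop → Tendsto (fun i => a i / √(β i)) l (𝓝 b) →
        TendstoUniformly (fun i => gaussHypergeometricCovariance d (a i) α (β i) γ)
          (laguerreKernel d b α γ) l) := by
  refine ⟨fun β hβ => ⟨isCovarianceKernel_laguerreKernel d hα hβ hb, fun a γ ha hγ hab =>
    tendstoUniformly_gaussHypergeometricCovariance d hα hβ hb ha hγ hab⟩,
    fun γ hγ => ⟨isCovarianceKernel_laguerreKernel d hα hγ hb, fun a β ha hβ hab => ?_⟩⟩
  simp_rw [fun i => gaussHypergeometricCovariance_symm d (a i) α (β i) γ]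
  exact tendstoUniformly_gaussHypergeometricCovariance d hα hγ hb ha hβ hab
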